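/- Let $n\ge 1$, let $\kappa>0$, and let $A=[a_{ij}]\in\mathbb C^{n\times n}$ with $a_{ii}=0$ for all $i$. Let $\mathcal G(A)$ be the digraph on $\{1,\dots,n\}$ with an edge from $j$ to $i$ if and only if $a_{ij}\ne 0$; it has a directed spanning tree if some vertex has a directed path to every other vertex. Let $L=D-A$ with $D=\operatorname{diag}(d_1,\dots,d_n)$, $d_i=\sum_{j}|a_{ij}|$. Let $\mathbb T=\{w\in\mathbb C: |w|=1\}$ and, for $\zeta\in\mathbb T^n$, $D_\zeta=\operatorname{diag}(\zeta)$. The matrix $A$ is called essentially nonnegative if there is $\zeta\in\mathbb T^n$ such that all entries of $D_\zeta^{-1}AD_\zeta$ are real and nonnegative. The system $\dot z(t)=-\kappa Lz(t)$, $t\ge 0$, $z(t)\in\mathbb C^n$, is said to reach complex consensus if for (Lebesgue) almost every initial state $z(0)\in\mathbb C^n$ there is $a>0$ with $\lim_{t\to\infty}|z_i(t)|=a$ for all $i=1,\dots,n$. Then the system reaches complex consensus if and only if $A$ is essentially nonnegative and $\mathcal G(A)$ has a directed spanning tree. In this case, there is $\zeta\in\mathbb T^n$ with $L\zeta=0$,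 and every solution of $Ly=0$ is a scalar multiple of $\zeta$; for each such $\zeta$ there is a unique vector of the form $\eta=D_\zeta^{-1}\nu$ where $\nu$ has real nonnegative entries, $\|\nu\|_1=1$ and $\nu^T D_\zeta^{-1}LD_\zeta=0$; it satisfies $\|\eta\|_1=1$ and $\eta^TL=0$; and for every initial state $z(0)\in\mathbb C^n$ $$\lim_{t\to\infty}z(t)=(\eta^Tz(0))\,\zeta .$$ -/

import Mathlib

open Filter Topology MeasureTheory

noncomputable section

namespace ComplexConsensus

/-- The digraph of `A`: there is an edge from `j` to `i` iff `a_{ij} ≠ 0`. -/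
def graph {n : ℕ} (A : Matrix (Fin n) (Fin n) ℂ) : Digraph (Fin n) where
  Adj j i := A i j ≠ 0

/-- Some vertex (a root) has a directed path to every vertex. -/
def HasSpanningTree {n : ℕ} (G : Digraph (Fin n)) : Prop :=
  ∃ r, ∀ i, Relation.ReflTransGen G.Adj r i

/-- The complex Laplacian `L = D - A`, with `D = diag (d_1, …, d_n)` and `d_i = ∑_j |a_{ij}|`
(the terms with `a_{ij} = 0` contribute nothing, so this is the sum over the neighbours). -/
def laplacian {n : ℕ} (A : Matrix (Fin n) (Fin n) ℂ) : Matrix (Fin n) (Fin n) ℂ :=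
  Matrix.diagonal (fun i => ((∑ j, ‖A i j‖ : ℝ) : ℂ)) - A

/-- `ζ ∈ 𝕋ⁿ`. -/
def IsUnimodular {n : ℕ} (ζ : Fin n → ℂ) : Prop := ∀ i, ‖ζ i‖ = 1

/-- All entries are real and nonnegative. -/
def IsNonnegative {n : ℕ} (B : Matrix (Fin n) (Fin n) ℂ) : Prop :=
  ∀ i j, 0 ≤ (B i j).re ∧ (B i j).im = 0

/-- The matrix `D_ζ⁻¹ M D_ζ`, where `D_ζ = diag ζ`. -/
def switch {n : ℕ} (ζ : Fin n → ℂ) (M : Matrix (Fin n) (Fin n) ℂ) : Matrix (Fin n) (Fin n) ℂ :=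
  (Matrix.diagonal ζ)⁻¹ * M * Matrix.diagonal ζ

def SwitchingEquivalent {n : ℕ} (A₁ A₂ : Matrix (Fin n) (Fin n) ℂ) : Prop :=
  ∃ ζ : Fin n → ℂ, IsUnimodular ζ ∧ A₂ = switch ζ A₁

def EssentiallyNonnegative {n : ℕ} (A : Matrix (Fin n) (Fin n) ℂ) : Prop :=
  ∃ B, IsNonnegative B ∧ SwitchingEquivalent A B

/-- `z` solves `ż = -κ L z` on `[0, ∞)` (with the right derivative at `0`). -/
def IsTrajectory {n : ℕ} (κ : ℝ) (A : Matrix (Fin n) (Fin n) ℂ) (z : ℝ → Fin n → ℂ) : Prop :=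
  ∀ t, 0 ≤ t →
    HasDerivWithinAt z (-((κ : ℂ) • (laplacian A).mulVec (z t))) (Set.Ici 0) t

/-- All the moduli `|z_i(t)|` tend to one and the same positive limit. -/
def HasPositiveCommonModulus {n : ℕ} (z : ℝ → Fin n → ℂ) : Prop :=
  ∃ a : ℝ, 0 < a ∧ ∀ i, Tendsto (fun t => ‖z t i‖) atTop (𝓝 a)

/-- The system `ż = -κ L z` reaches complex consensus: for (Lebesgue) almost every initial state
the moduli of all the agents tend to one and the same positive limit. No linear system has this
property for every initial state, since the solution that starts at `0` stays there. -/
def ReachesComplexConsensus {n : ℕ} (κ : ℝ) (A : Matrix (Fin n) (Fin n) ℂ) : Prop :=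
  ∀ᵐ z₀ : Fin n → ℂ, ∀ z : ℝ → Fin n → ℂ,
    IsTrajectory κ A z → z 0 = z₀ → HasPositiveCommonModulus z

/-- `‖x‖₁`. -/
def oneNorm {n : ℕ} (x : Fin n → ℂ) : ℝ := ∑ i, ‖x i‖

/-- `η = D_ζ⁻¹ ν`, where `ν` is a nonnegative left zero-eigenvector of `D_ζ⁻¹ L D_ζ`
with `‖ν‖₁ = 1`. -/
def IsNormalizedLeftEigenvector {n : ℕ} (A : Matrix (Fin n) (Fin n) ℂ) (ζ η : Fin n → ℂ) : Prop :=
  ∃ ν : Fin n → ℂ, (∀ i, 0 ≤ (ν i).re ∧ (ν i).im = 0) ∧ oneNorm ν = 1 ∧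
    Matrix.vecMul ν (switch ζ (laplacian A)) = 0 ∧ η = (Matrix.diagonal ζ)⁻¹.mulVec ν

end ComplexConsensus

end

/-!
Put `r = ∑ i, ∑ j, ‖A i j‖`. In the sup norm `‖r - L‖ ≤ r`, so expanding
`exp (-t L) = exp (-t r) exp (t (r - L))` in powers of `(r - L) / r` exhibits it as an average of
contractions with the Poisson weights of mean `t r`; in particular it is a contraction. The same
expansion of `exp (-t L) t L` has the coefficients of a Poisson variable minus its mean, and the
mean absolute deviation is at most the standard deviation, so `‖exp (-t L) L‖ ≤ √(r / t) → 0`.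
Hence `ker L` and `range L` are complementary, and every trajectory converges to the projection
`P` of its initial state onto `ker L` along `range L`.

Consensus is therefore a property of `P`. Equality in the triangle inequality shows that the
unimodular `ζ ∈ ker L` are exactly those for which `D_ζ⁻¹ A D_ζ` is nonnegative, and, propagated
along edges from a coordinate of maximal modulus, that a root makes `ker L` one-dimensional.
Conversely, `P` preserves the vectors vanishing on a set closed under predecessors. If `i` and `j`
have no common ancestor, truncate `ζ` to the ancestors of `j`: the image under `P` has modulus `0`
at `i` and `1` at `j`, whereas consensus for almost every initial state makes all moduli of `P x`
agree for every `x`. So any two vertices have a common ancestor, and by finiteness there is a root.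

The vector `η` is defined by `P x = (ηᵀ x) ζ`. From `‖P‖ ≤ 1` one gets `‖η‖₁ ≤ 1`, and `ηᵀ ζ = 1`
then forces equality in `|ηᵀ ζ| ≤ ‖η‖₁`, which is the nonnegativity of `ν = D_ζ η`.
-/

noncomputable section

namespace ComplexConsensus

section BanachAlgebra

open NormedSpace

variable {𝔸 : Type*} [NormedRing 𝔸] [NormedAlgebra ℝ 𝔸] {a : 𝔸} {s : ℝ}

theorem norm_algebraMap_mul_sub_smul_le (h : ‖algebraMap ℝ 𝔸 s - a‖ ≤ s) {t : ℝ} (ht : 0 ≤ t) :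
    ‖algebraMap ℝ 𝔸 (t * s) - t • a‖ ≤ t * s := by
  rw [map_mul, ← Algebra.smul_def, ← smul_sub, norm_smul, Real.norm_of_nonneg ht]
  gcongr

variable [CompleteSpace 𝔸]

theorem hasSum_natCast_div_factorial_smul_pow (b : 𝔸) :
    HasSum (fun k : ℕ => ((k : ℝ) / k.factorial) • b ^ k) (exp b * b) := by
  refine (hasSum_nat_add_iff' 1).mp ?_
  have h := (exp_series_hasSum_exp' (𝕂 := ℝ) b).mul_right b
  simp only [smul_mul_assoc, ← pow_succ] at h
  simpa [Nat.factorial_succ, div_mul_cancel_left₀, Nat.cast_add_one_ne_zero] using h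

theorem hasSum_pow_div_factorial (s : ℝ) :
    HasSum (fun k : ℕ => s ^ k / k.factorial) (Real.exp s) := by
  simpa [Real.exp_eq_exp_ℝ] using expSeries_div_hasSum_exp s

/-- Up to the factor `exp (-s)`, this is the variance of a Poisson variable. -/
theorem hasSum_pow_div_factorial_mul_sub_sq (s : ℝ) :
    HasSum (fun k : ℕ => s ^ k / k.factorial * (k - s) ^ 2) (Real.exp s * s) := by
  have zeroth := hasSum_pow_div_factorial s
  have first : HasSum (fun k : ℕ => s ^ k / k.factorial * k) (Real.exp s * s) := by
    rw [Real.exp_eq_exp_ℝ]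
    exact (hasSum_natCast_div_factorial_smul_pow s).congr_fun fun k => by
      rw [smul_eq_mul]; ring
  have second : HasSum (fun k : ℕ => s ^ k / k.factorial * k ^ 2)
      (s * (Real.exp s * s + Real.exp s)) := by
    refine (hasSum_nat_add_iff' 1).mp ?_
    convert! (first.add zeroth).mul_left s using 1
    · ext k
      rw [Nat.factorial_succ, pow_succ']
      push_cast
      field_simp
    · simp
  convert! (second.sub (first.mul_left (2 * s))).add (zeroth.mul_left (s ^ 2)) using 1
  · ext k
    ring
  · ring

theorem pow_div_factorial_mul_abs_sub_le {s : ℝ} (hs : 0 < s) (k : ℕ) :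
    s ^ k / k.factorial * |s - k| ≤
      (√s * (s ^ k / k.factorial) + (√s)⁻¹ * (s ^ k / k.factorial * (k - s) ^ 2)) / 2 := by
  have hpos : 0 < √s := Real.sqrt_pos.mpr hs
  have hamgm : |s - k| ≤ (√s + (√s)⁻¹ * (k - s) ^ 2) / 2 := by
    have h := two_mul_le_add_sq (√s) |s - k|
    rw [sq_abs] at h
    rw [← mul_le_mul_iff_right₀ hpos]
    field_simp
    nlinarith
  calc s ^ k / k.factorial * |s - k|
      ≤ s ^ k / k.factorial * ((√s + (√s)⁻¹ * (k - s) ^ 2) / 2) := by gcongr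
    _ = _ := by ring

theorem exp_neg_eq_smul_exp_algebraMap_sub (a : 𝔸) (s : ℝ) :
    exp (-a) = Real.exp (-s) • exp (algebraMap ℝ 𝔸 s - a) := by
  let _ : NormedAlgebra ℚ 𝔸 := NormedAlgebra.restrictScalars ℚ ℝ 𝔸
  rw [Real.exp_eq_exp_ℝ, Algebra.smul_def, algebraMap_exp_comm,
    ← exp_add_of_commute (Algebra.commutes _ _), map_neg]
  congr 1
  abel

variable [NormOneClass 𝔸]

theorem norm_exp_neg_le_one (h : ‖algebraMap ℝ 𝔸 s - a‖ ≤ s) : ‖exp (-a)‖ ≤ 1 := by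
  set b := algebraMap ℝ 𝔸 s - a
  have hexp : ‖exp b‖ ≤ Real.exp s := by
    refine (exp_series_hasSum_exp' (𝕂 := ℝ) b).norm_le_of_bounded (hasSum_pow_div_factorial s)
      fun k => ?_
    rw [norm_smul, norm_inv, RCLike.norm_natCast, inv_mul_eq_div]
    gcongr
    exact (norm_pow_le b k).trans (by gcongr)
  calc ‖exp (-a)‖ = Real.exp (-s) * ‖exp b‖ := by
        rw [exp_neg_eq_smul_exp_algebraMap_sub a s, norm_smul,
          Real.norm_of_nonneg (Real.exp_nonneg _)]
    _ ≤ Real.exp (-s) * Real.exp s := by gcongr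
    _ = 1 := by rw [← Real.exp_add, neg_add_cancel, Real.exp_zero]

theorem norm_exp_neg_mul_le_sqrt (h : ‖algebraMap ℝ 𝔸 s - a‖ ≤ s) : ‖exp (-a) * a‖ ≤ √s := by
  rcases ((norm_nonneg _).trans h).eq_or_lt with rfl | hs
  · have ha : a = 0 := by simpa using h
    simp [ha]
  set b := algebraMap ℝ 𝔸 s - a with hb
  have hsum : HasSum (fun k : ℕ => ((k.factorial : ℝ)⁻¹ * (s - k)) • b ^ k) (exp b * a) := by
    convert! ((exp_series_hasSum_exp' (𝕂 := ℝ) b).mul_right (algebraMap ℝ 𝔸 s)).sub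
      (hasSum_natCast_div_factorial_smul_pow b) using 1
    · ext k
      rw [← Algebra.commutes, ← Algebra.smul_def, smul_smul, ← sub_smul]
      ring_nf
    · rw [← mul_sub, hb, sub_sub_cancel]
  have hexp : ‖exp b * a‖ ≤ Real.exp s * √s := by
    have hmajorant := (((hasSum_pow_div_factorial s).mul_left √s).add
      ((hasSum_pow_div_factorial_mul_sub_sq s).mul_left (√s)⁻¹)).div_const 2
    have htotal : (√s * Real.exp s + (√s)⁻¹ * (Real.exp s * s)) / 2 = Real.exp s * √s := by
      field_simp
      nlinarith [Real.sq_sqrt hs.le]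
    rw [htotal] at hmajorant
    refine hsum.norm_le_of_bounded hmajorant fun k =>
      le_trans ?_ (pow_div_factorial_mul_abs_sub_le hs k)
    rw [norm_smul, norm_mul, norm_inv, RCLike.norm_natCast, Real.norm_eq_abs, mul_right_comm,
      inv_mul_eq_div]
    gcongr
    exact (norm_pow_le b k).trans (by gcongr)
  calc ‖exp (-a) * a‖ = Real.exp (-s) * ‖exp b * a‖ := by
        rw [exp_neg_eq_smul_exp_algebraMap_sub a s, smul_mul_assoc, norm_smul,
          Real.norm_of_nonneg (Real.exp_nonneg _)]
    _ ≤ Real.exp (-s) * (Real.exp s * √s) := by gcongr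
    _ = √s := by rw [← mul_assoc, ← Real.exp_add, neg_add_cancel, Real.exp_zero, one_mul]

end BanachAlgebra

section Semigroup

open NormedSpace

variable {E : Type*} [NormedAddCommGroup E] [NormedSpace ℂ E] [CompleteSpace E]
  {L T : E →L[ℂ] E} {r : ℝ} {V : Submodule ℂ E} {x : E}

theorem hasSum_exp_apply (T : E →L[ℂ] E) (x : E) :
    HasSum (fun k : ℕ => (k.factorial : ℂ)⁻¹ • (T ^ k) x) (exp T x) := by
  simpa using (exp_series_hasSum_exp' (𝕂 := ℂ) T).mapL (ContinuousLinearMap.apply ℂ E x)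

theorem exp_apply_mem (hV : IsClosed (V : Set E)) (hT : ∀ x ∈ V, T x ∈ V) (hx : x ∈ V) :
    exp T x ∈ V := by
  have hpow (k : ℕ) : (T ^ k) x ∈ V := by
    induction k with
    | zero => exact hx
    | succ k ih => exact pow_succ' T k ▸ hT _ ih
  exact hV.mem_of_tendsto (hasSum_exp_apply T x)
    (.of_forall fun s => V.sum_mem fun k _ => V.smul_mem _ (hpow k))

theorem exp_apply_of_apply_eq_zero (hx : T x = 0) : exp T x = x := by
  refine (hasSum_exp_apply T x).unique ?_
  convert! hasSum_single (f := fun k : ℕ => (k.factorial : ℂ)⁻¹ • (T ^ k) x) 0 fun k hk => ?_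
  · simp
  · obtain ⟨k, rfl⟩ := Nat.exists_eq_succ_of_ne_zero hk
    rw [Nat.succ_eq_add_one, pow_succ, mul_apply_eq_comp, hx, map_zero, smul_zero]

theorem hasDerivAt_exp_smul_apply (T : E →L[ℂ] E) (x : E) (t : ℝ) :
    HasDerivAt (fun s : ℝ => exp (s • T) x) (T (exp (t • T) x)) t :=
  ((ContinuousLinearMap.apply ℂ E x).restrictScalars ℝ).hasFDerivAt.comp_hasDerivAt t
    (hasDerivAt_exp_smul_const' (𝕂 := ℝ) T t)

theorem eq_exp_smul_apply_of_hasDerivWithinAt {z : ℝ → E}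
    (hz : ∀ t, 0 ≤ t → HasDerivWithinAt z (T (z t)) (Set.Ici 0) t) {t : ℝ} (ht : 0 ≤ t) :
    z t = exp (t • T) (z 0) :=
  have hexp := hasDerivAt_exp_smul_apply T (z 0)
  ODE_solution_unique (v := fun _ => T) (K := ‖T‖₊) (fun _ => T.lipschitz)
    (fun s hs => (hz s hs.1).continuousWithinAt.mono Set.Icc_subset_Ici_self)
    (fun s hs => (hz s hs.1).mono (Set.Ici_subset_Ici.mpr hs.1))
    (fun s _ => (hexp s).continuousAt.continuousWithinAt)
    (fun s _ => (hexp s).hasDerivWithinAt) (by simp) ⟨ht, le_rfl⟩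

variable [Nontrivial E] (hL : ‖algebraMap ℝ (E →L[ℂ] E) r - L‖ ≤ r)
include hL

theorem norm_exp_neg_smul_mul_le {t : ℝ} (ht : 0 < t) : ‖exp (-(t • L)) * L‖ ≤ √(t * r) / t := by
  have hbound := norm_exp_neg_mul_le_sqrt (norm_algebraMap_mul_sub_smul_le hL ht.le)
  rwa [mul_smul_comm, norm_smul, Real.norm_of_nonneg ht.le, ← le_div_iff₀' ht] at hbound

theorem tendsto_exp_neg_smul_apply_map (x : E) :
    Tendsto (fun t : ℝ => exp (-(t • L)) (L x)) atTop (𝓝 0) := by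
  have hdecay : Tendsto (fun t : ℝ => √r * (√t)⁻¹ * ‖x‖) atTop (𝓝 0) := by
    simpa using (Real.tendsto_sqrt_atTop.inv_tendsto_atTop.const_mul √r).mul_const ‖x‖
  refine squeeze_zero_norm' ?_ hdecay
  filter_upwards [eventually_gt_atTop 0] with t ht
  refine ((exp (-(t • L)) * L).le_of_opNorm_le (norm_exp_neg_smul_mul_le hL ht) x).trans_eq ?_
  rw [Real.sqrt_mul ht.le, mul_comm √t, mul_div_assoc, Real.sqrt_div_self]

theorem tendsto_exp_neg_smul_apply_add {y : E} (hy : L y = 0) (x : E) :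
    Tendsto (fun t : ℝ => exp (-(t • L)) (y + L x)) atTop (𝓝 y) := by
  have hfix (t : ℝ) : exp (-(t • L)) y = y := exp_apply_of_apply_eq_zero (by simp [hy])
  simpa [hfix] using (tendsto_exp_neg_smul_apply_map hL x).const_add y

theorem disjoint_ker_range : Disjoint L.ker L.range := by
  rw [Submodule.disjoint_def]
  rintro _ hker ⟨x, rfl⟩
  have h := tendsto_exp_neg_smul_apply_add hL hker 0
  simp only [map_zero, add_zero] at h
  exact tendsto_nhds_unique h (tendsto_exp_neg_smul_apply_map hL x)

variable [FiniteDimensional ℂ E]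

theorem isCompl_ker_range : IsCompl L.ker L.range :=
  (Submodule.isCompl_iff_disjoint _ _
    (by rw [add_comm, LinearMap.finrank_range_add_finrank_ker])).mpr (disjoint_ker_range hL)

theorem tendsto_exp_neg_smul_apply_projection (x : E) :
    Tendsto (fun t : ℝ => exp (-(t • L)) x) atTop
      (𝓝 (L.ker.projection L.range (isCompl_ker_range hL) x)) := by
  set P := L.ker.projection L.range (isCompl_ker_range hL)
  obtain ⟨w, hw⟩ := Submodule.projection_apply_mem (isCompl_ker_range hL).symm x
  rw [Submodule.projection_eq_self_sub_projection (isCompl_ker_range hL)] at hw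
  have hker : L (P x) = 0 := LinearMap.mem_ker.mp (Submodule.projection_apply_mem _ x)
  have hlim := tendsto_exp_neg_smul_apply_add hL hker w
  rwa [show L w = x - P x from hw, add_sub_cancel] at hlim

theorem norm_projection_ker_le (x : E) :
    ‖L.ker.projection L.range (isCompl_ker_range hL) x‖ ≤ ‖x‖ := by
  refine le_of_tendsto (tendsto_exp_neg_smul_apply_projection hL x).norm ?_
  filter_upwards [eventually_ge_atTop 0] with t ht
  simpa using (exp (-(t • L))).le_of_opNorm_le
    (norm_exp_neg_le_one (norm_algebraMap_mul_sub_smul_le hL ht)) x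

theorem projection_ker_mem (hV : ∀ x ∈ V, L x ∈ V) (hx : x ∈ V) :
    L.ker.projection L.range (isCompl_ker_range hL) x ∈ V :=
  V.closed_of_finiteDimensional.mem_of_tendsto (tendsto_exp_neg_smul_apply_projection hL x)
    (.of_forall fun t => exp_apply_mem V.closed_of_finiteDimensional
      (fun y hy => V.neg_mem (V.smul_of_tower_mem t (hV y hy))) hx)

end Semigroup

section Flow

open NormedSpace

variable {n : ℕ} {A : Matrix (Fin n) (Fin n) ℂ} {κ : ℝ} {x : Fin n → ℂ} {z : ℝ → Fin n → ℂ}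

theorem laplacian_mulVec_apply (A : Matrix (Fin n) (Fin n) ℂ) (x : Fin n → ℂ) (i : Fin n) :
    (laplacian A).mulVec x i = ((∑ j, ‖A i j‖ : ℝ) : ℂ) * x i - ∑ j, A i j * x j := by
  rw [laplacian, Matrix.sub_mulVec, Pi.sub_apply, Matrix.mulVec_diagonal]
  rfl

/-- The Laplacian as an operator on `ℂⁿ` with the sup norm, for which `exp (-t L)` is a
contraction. -/
def laplacianOp (A : Matrix (Fin n) (Fin n) ℂ) : (Fin n → ℂ) →L[ℂ] (Fin n → ℂ) :=
  (laplacian A).mulVecLin.toContinuousLinearMap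

theorem laplacianOp_apply (A : Matrix (Fin n) (Fin n) ℂ) (x : Fin n → ℂ) :
    laplacianOp A x = (laplacian A).mulVec x := rfl

theorem norm_algebraMap_sub_laplacianOp_le (A : Matrix (Fin n) (Fin n) ℂ) :
    ‖algebraMap ℝ ((Fin n → ℂ) →L[ℂ] (Fin n → ℂ)) (∑ i, ∑ j, ‖A i j‖) - laplacianOp A‖ ≤
      ∑ i, ∑ j, ‖A i j‖ := by
  set r := ∑ i, ∑ j, ‖A i j‖
  refine ContinuousLinearMap.opNorm_le_bound _ (by positivity) fun x => ?_
  refine (pi_norm_le_iff_of_nonneg (by positivity)).mpr fun i => ?_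
  have hrow : ∑ j, ‖A i j‖ ≤ r :=
    Finset.single_le_sum (f := fun i => ∑ j, ‖A i j‖) (fun i _ => by positivity)
      (Finset.mem_univ i)
  have happly : (algebraMap ℝ ((Fin n → ℂ) →L[ℂ] (Fin n → ℂ)) r - laplacianOp A) x i =
      ((r - ∑ j, ‖A i j‖ : ℝ) : ℂ) * x i + ∑ j, A i j * x j := by
    rw [Algebra.algebraMap_eq_smul_one]
    simp only [sub_apply, smul_apply, one_apply_eq_self, Pi.sub_apply, Pi.smul_apply,
      Complex.real_smul, laplacianOp_apply, laplacian_mulVec_apply]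
    push_cast
    ring
  calc ‖_‖ ≤ ‖((r - ∑ j, ‖A i j‖ : ℝ) : ℂ) * x i‖ + ∑ j, ‖A i j * x j‖ :=
        happly ▸ (norm_add_le _ _).trans (by gcongr; exact norm_sum_le _ _)
    _ ≤ (r - ∑ j, ‖A i j‖) * ‖x‖ + ∑ j, ‖A i j‖ * ‖x‖ := by
        rw [norm_mul, Complex.norm_real, Real.norm_of_nonneg (sub_nonneg.mpr hrow)]
        gcongr with j
        · exact norm_le_pi_norm x i
        · exact (norm_mul_le _ _).trans (by gcongr; exact norm_le_pi_norm x j)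
    _ = r * ‖x‖ := by rw [← Finset.sum_mul]; ring

theorem isTrajectory_exp (κ : ℝ) (A : Matrix (Fin n) (Fin n) ℂ) (x : Fin n → ℂ) :
    IsTrajectory κ A fun t => exp (t • -((κ : ℂ) • laplacianOp A)) x := fun t _ =>
  (hasDerivAt_exp_smul_apply (-((κ : ℂ) • laplacianOp A)) x t).hasDerivWithinAt

theorem IsTrajectory.eq_exp (hz : IsTrajectory κ A z) {t : ℝ} (ht : 0 ≤ t) :
    z t = exp (t • -((κ : ℂ) • laplacianOp A)) (z 0) :=
  eq_exp_smul_apply_of_hasDerivWithinAt (T := -((κ : ℂ) • laplacianOp A)) hz ht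

variable [NeZero n]

/-- The projection of `ℂⁿ` onto the kernel of the Laplacian along its range: it sends an initial
state to the limit of the trajectory. -/
def consensusProjection (A : Matrix (Fin n) (Fin n) ℂ) : (Fin n → ℂ) →ₗ[ℂ] (Fin n → ℂ) :=
  (laplacianOp A).ker.projection (laplacianOp A).range
    (isCompl_ker_range (norm_algebraMap_sub_laplacianOp_le A))

theorem laplacian_mulVec_consensusProjection (A : Matrix (Fin n) (Fin n) ℂ) (x : Fin n → ℂ) :
    (laplacian A).mulVec (consensusProjection A x) = 0 :=
  Submodule.projection_apply_mem (isCompl_ker_range (norm_algebraMap_sub_laplacianOp_le A)) x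

theorem consensusProjection_eq_self (hx : (laplacian A).mulVec x = 0) :
    consensusProjection A x = x :=
  Submodule.projection_apply_of_mem_left _ hx

theorem consensusProjection_laplacian_mulVec (A : Matrix (Fin n) (Fin n) ℂ) (x : Fin n → ℂ) :
    consensusProjection A ((laplacian A).mulVec x) = 0 :=
  (Submodule.projection_apply_eq_zero_iff _).mpr ⟨x, rfl⟩

theorem dotProduct_consensusProjection {η : Fin n → ℂ} (hη : Matrix.vecMul η (laplacian A) = 0)
    (x : Fin n → ℂ) : η ⬝ᵥ consensusProjection A x = η ⬝ᵥ x := by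
  obtain ⟨w, hw⟩ := Submodule.projection_apply_mem
    (isCompl_ker_range (norm_algebraMap_sub_laplacianOp_le A)).symm x
  have hsplit : consensusProjection A x + (laplacian A).mulVec w = x :=
    (congrArg _ hw).trans (Submodule.projection_add_projection_eq_self _ x)
  rw [← hsplit, dotProduct_add, Matrix.dotProduct_mulVec, hη, zero_dotProduct, add_zero, hsplit]

theorem norm_consensusProjection_le (A : Matrix (Fin n) (Fin n) ℂ) (x : Fin n → ℂ) :
    ‖consensusProjection A x‖ ≤ ‖x‖ :=
  norm_projection_ker_le (norm_algebraMap_sub_laplacianOp_le A) x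

theorem IsTrajectory.tendsto_consensusProjection (hκ : 0 < κ) (hz : IsTrajectory κ A z) :
    Tendsto z atTop (𝓝 (consensusProjection A (z 0))) := by
  have hlim := (tendsto_exp_neg_smul_apply_projection (norm_algebraMap_sub_laplacianOp_le A)
    (z 0)).comp (tendsto_id.const_mul_atTop hκ)
  refine hlim.congr' ?_
  filter_upwards [eventually_ge_atTop 0] with t ht
  have hgen : t • -((κ : ℂ) • laplacianOp A) = -((κ * t) • laplacianOp A) := by
    ext y i
    simp [mul_left_comm, mul_assoc]
  rw [hz.eq_exp ht, hgen]
  rfl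

theorem reachesComplexConsensus_iff (hκ : 0 < κ) :
    ReachesComplexConsensus κ A ↔
      ∀ᵐ x : Fin n → ℂ, ∃ a : ℝ, 0 < a ∧ ∀ i, ‖consensusProjection A x i‖ = a := by
  refine eventually_congr (.of_forall fun x => ⟨fun h => ?_, ?_⟩)
  · have htraj := isTrajectory_exp κ A x
    have hinit : exp ((0 : ℝ) • -((κ : ℂ) • laplacianOp A)) x = x := by simp
    have hlim := htraj.tendsto_consensusProjection hκ
    rw [hinit] at hlim
    obtain ⟨a, ha, hmod⟩ := h _ htraj hinit
    exact ⟨a, ha, fun i => tendsto_nhds_unique (tendsto_pi_nhds.mp hlim i).norm (hmod i)⟩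
  · rintro ⟨a, ha, hnorm⟩ z hz rfl
    exact ⟨a, ha, fun i =>
      hnorm i ▸ (tendsto_pi_nhds.mp (hz.tendsto_consensusProjection hκ) i).norm⟩

end Flow

section Kernel

variable {n : ℕ} {A : Matrix (Fin n) (Fin n) ℂ} {ζ y : Fin n → ℂ}

open ComplexOrder in
theorem eq_ofReal_norm_of_nonneg {w : ℂ} (hre : 0 ≤ w.re) (him : w.im = 0) : w = (‖w‖ : ℂ) :=
  Complex.eq_coe_norm_of_nonneg (Complex.nonneg_iff.mpr ⟨hre, him.symm⟩)

theorem eq_ofReal_of_sum_eq_ofReal_sum {ι : Type*} [Fintype ι] {b : ι → ℂ} {c : ι → ℝ}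
    (hb : ∀ j, ‖b j‖ ≤ c j) (hsum : ∑ j, b j = ((∑ j, c j : ℝ) : ℂ)) (j : ι) : b j = c j := by
  have hre_le (j : ι) : (b j).re ≤ c j := (Complex.re_le_norm _).trans (hb j)
  have hre_sum : ∑ j, (b j).re = ∑ j, c j := by simpa using congrArg Complex.re hsum
  have hre : (b j).re = c j :=
    (Finset.sum_eq_sum_iff_of_le fun j _ => hre_le j).mp hre_sum j (Finset.mem_univ j)
  have hnorm : (b j).re = ‖b j‖ := le_antisymm (Complex.re_le_norm _) (hre ▸ hb j)
  rw [← hre, hnorm]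
  exact Complex.eq_coe_norm_of_nonneg (Complex.re_eq_norm.mp hnorm)

theorem mul_eq_norm_mul_of_forall_norm_le (hy : (laplacian A).mulVec y = 0) {i : Fin n}
    (hi : ∀ j, ‖y j‖ ≤ ‖y i‖) (j : Fin n) : A i j * y j = ‖A i j‖ * y i := by
  by_cases h0 : y i = 0
  · have hj : y j = 0 := by simpa [h0] using hi j
    rw [h0, hj, mul_zero, mul_zero]
  have hrow : ((∑ j, ‖A i j‖ : ℝ) : ℂ) * y i = ∑ j, A i j * y j := by
    rw [← sub_eq_zero, ← laplacian_mulVec_apply, hy, Pi.zero_apply]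
  have hterm (j : Fin n) : ‖A i j * y j / y i‖ ≤ ‖A i j‖ := by
    rw [norm_div, norm_mul, div_le_iff₀ (norm_pos_iff.mpr h0)]
    gcongr
    exact hi j
  have hsum : ∑ j, A i j * y j / y i = ((∑ j, ‖A i j‖ : ℝ) : ℂ) := by
    rw [← Finset.sum_div, ← hrow, mul_div_cancel_right₀ _ h0]
  exact (div_eq_iff h0).mp (eq_ofReal_of_sum_eq_ofReal_sum hterm hsum j)

theorem eq_zero_of_laplacian_mulVec_eq_zero {r : Fin n}
    (hr : ∀ i, Relation.ReflTransGen (graph A).Adj r i) (hy : (laplacian A).mulVec y = 0)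
    (hyr : y r = 0) : y = 0 := by
  have : Nonempty (Fin n) := ⟨r⟩
  obtain ⟨i, hi⟩ := Finite.exists_max fun j => ‖y j‖
  have hpath (k : Fin n) (hk : Relation.ReflTransGen (graph A).Adj k i) : ‖y k‖ = ‖y i‖ := by
    induction hk using Relation.ReflTransGen.head_induction_on with
    | refl => rfl
    | @head k l hkl _ ih =>
      have hmul := congrArg norm (mul_eq_norm_mul_of_forall_norm_le hy (i := l)
        (fun j => ih ▸ hi j) k)
      rw [norm_mul, norm_mul, Complex.norm_real, norm_norm] at hmul
      exact (mul_left_cancel₀ (norm_ne_zero_iff.mpr hkl) hmul).trans ih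
  have hmax : ‖y i‖ = 0 := by rw [← hpath r (hr i), hyr, norm_zero]
  exact funext fun j => norm_le_zero_iff.mp ((hi j).trans hmax.le)

theorem IsUnimodular.ne_zero (hζ : IsUnimodular ζ) (i : Fin n) : ζ i ≠ 0 :=
  norm_ne_zero_iff.mp (by rw [hζ i]; exact one_ne_zero)

theorem IsUnimodular.inv_diagonal (hζ : IsUnimodular ζ) :
    (Matrix.diagonal ζ)⁻¹ = Matrix.diagonal fun i => (ζ i)⁻¹ :=
  Matrix.inv_eq_left_inv (by simp [Matrix.diagonal_mul_diagonal, hζ.ne_zero])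

theorem IsUnimodular.switch_apply (hζ : IsUnimodular ζ) (M : Matrix (Fin n) (Fin n) ℂ)
    (i j : Fin n) : switch ζ M i j = (ζ i)⁻¹ * M i j * ζ j := by
  rw [switch, hζ.inv_diagonal, Matrix.mul_diagonal, Matrix.diagonal_mul]

theorem eq_smul_of_laplacian_mulVec_eq_zero (hG : HasSpanningTree (graph A)) (hζ : IsUnimodular ζ)
    (hLζ : (laplacian A).mulVec ζ = 0) (hy : (laplacian A).mulVec y = 0) :
    ∃ c : ℂ, y = c • ζ := by
  obtain ⟨r, hr⟩ := hG
  refine ⟨y r / ζ r, sub_eq_zero.mp (eq_zero_of_laplacian_mulVec_eq_zero hr ?_ ?_)⟩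
  · rw [Matrix.mulVec_sub, Matrix.mulVec_smul, hy, hLζ, smul_zero, sub_zero]
  · simp [hζ.ne_zero r]

theorem IsUnimodular.laplacian_mulVec_eq_zero_iff (hζ : IsUnimodular ζ) :
    (laplacian A).mulVec ζ = 0 ↔ ∀ i j, A i j * ζ j = ‖A i j‖ * ζ i := by
  refine ⟨fun h i => mul_eq_norm_mul_of_forall_norm_le h fun j => by rw [hζ i, hζ j], fun h => ?_⟩
  funext i
  simp [laplacian_mulVec_apply, h, Finset.sum_mul]

theorem IsUnimodular.isNonnegative_switch_iff (hζ : IsUnimodular ζ) :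
    IsNonnegative (switch ζ A) ↔ ∀ i j, A i j * ζ j = ‖A i j‖ * ζ i := by
  refine forall₂_congr fun i j => ?_
  have hnorm : ‖switch ζ A i j‖ = ‖A i j‖ := by simp [hζ.switch_apply, hζ i, hζ j]
  have hmul : switch ζ A i j * ζ i = A i j * ζ j := by
    rw [hζ.switch_apply]
    field_simp [hζ.ne_zero i]
  rw [← hmul, mul_left_inj' (hζ.ne_zero i), ← hnorm]
  refine ⟨fun h => eq_ofReal_norm_of_nonneg h.1 h.2, fun h => ?_⟩
  rw [h]
  simp

theorem essentiallyNonnegative_iff :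
    EssentiallyNonnegative A ↔ ∃ ζ, IsUnimodular ζ ∧ (laplacian A).mulVec ζ = 0 := by
  constructor
  · rintro ⟨_, hB, ζ, hζ, rfl⟩
    exact ⟨ζ, hζ, hζ.laplacian_mulVec_eq_zero_iff.mpr (hζ.isNonnegative_switch_iff.mp hB)⟩
  · rintro ⟨ζ, hζ, hLζ⟩
    exact ⟨_, hζ.isNonnegative_switch_iff.mpr (hζ.laplacian_mulVec_eq_zero_iff.mp hLζ), ζ, hζ, rfl⟩

end Kernel

section LeftEigenvector

variable {n : ℕ} {A : Matrix (Fin n) (Fin n) ℂ} {ζ η ν x : Fin n → ℂ}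

theorem forall_nonneg_iff_sum_eq_oneNorm :
    (∀ i, 0 ≤ (ν i).re ∧ (ν i).im = 0) ↔ ∑ i, ν i = (oneNorm ν : ℂ) := by
  refine ⟨fun h => ?_, fun h i => ?_⟩
  · rw [oneNorm, Complex.ofReal_sum]
    exact Finset.sum_congr rfl fun i _ => eq_ofReal_norm_of_nonneg (h i).1 (h i).2
  · rw [eq_ofReal_of_sum_eq_ofReal_sum (fun _ => le_rfl) h i]
    simp

theorem IsUnimodular.oneNorm_mul (hζ : IsUnimodular ζ) (η : Fin n → ℂ) :
    oneNorm (η * ζ) = oneNorm η := by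
  simp [oneNorm, hζ _]

theorem IsUnimodular.eq_inv_diagonal_mulVec_iff (hζ : IsUnimodular ζ) :
    η = (Matrix.diagonal ζ)⁻¹.mulVec ν ↔ ν = η * ζ := by
  simp only [hζ.inv_diagonal, funext_iff, Matrix.mulVec_diagonal, Pi.mul_apply]
  exact forall_congr' fun i => by rw [inv_mul_eq_div, eq_div_iff (hζ.ne_zero i), eq_comm]

theorem IsUnimodular.vecMul_mul_switch (hζ : IsUnimodular ζ) (η : Fin n → ℂ)
    (M : Matrix (Fin n) (Fin n) ℂ) :
    Matrix.vecMul (η * ζ) (switch ζ M) = Matrix.vecMul η M * ζ := by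
  funext j
  simp only [Matrix.vecMul, dotProduct, Pi.mul_apply, hζ.switch_apply, Finset.sum_mul]
  exact Finset.sum_congr rfl fun i _ => by field_simp [hζ.ne_zero i]

theorem IsUnimodular.isNormalizedLeftEigenvector_iff (hζ : IsUnimodular ζ) :
    IsNormalizedLeftEigenvector A ζ η ↔
      oneNorm η = 1 ∧ Matrix.vecMul η (laplacian A) = 0 ∧ η ⬝ᵥ ζ = 1 := by
  have hvecMul : Matrix.vecMul (η * ζ) (switch ζ (laplacian A)) = 0 ↔
      Matrix.vecMul η (laplacian A) = 0 := by
    simp [hζ.vecMul_mul_switch, funext_iff, hζ.ne_zero]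
  have hdot : ∑ i, (η * ζ) i = η ⬝ᵥ ζ := rfl
  simp only [IsNormalizedLeftEigenvector, hζ.eq_inv_diagonal_mulVec_iff,
    forall_nonneg_iff_sum_eq_oneNorm, ← and_assoc, exists_eq_right, hvecMul, hdot, hζ.oneNorm_mul]
  constructor
  · rintro ⟨⟨hsum, hone⟩, hleft⟩
    exact ⟨⟨hone, hleft⟩, by rw [hsum, hone, Complex.ofReal_one]⟩
  · rintro ⟨⟨hone, hleft⟩, hsum⟩
    exact ⟨⟨by rw [hsum, hone, Complex.ofReal_one], hone⟩, hleft⟩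

theorem IsUnimodular.norm_dotProduct_le_oneNorm (hx : IsUnimodular x) (η : Fin n → ℂ) :
    ‖η ⬝ᵥ x‖ ≤ oneNorm η :=
  (norm_sum_le _ _).trans_eq (hx.oneNorm_mul η)

theorem exists_isUnimodular_dotProduct_eq_oneNorm (η : Fin n → ℂ) :
    ∃ x, IsUnimodular x ∧ η ⬝ᵥ x = (oneNorm η : ℂ) := by
  refine ⟨fun i => Complex.exp ((-(η i).arg : ℝ) * Complex.I),
    fun i => Complex.norm_exp_ofReal_mul_I _, ?_⟩
  rw [oneNorm, Complex.ofReal_sum]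
  refine Finset.sum_congr rfl fun i _ => ?_
  nth_rw 1 [← Complex.norm_mul_exp_arg_mul_I (η i)]
  rw [mul_assoc, ← Complex.exp_add]
  simp

variable [NeZero n]

theorem IsUnimodular.oneNorm_le_one_of_consensusProjection (hζ : IsUnimodular ζ)
    (hP : ∀ x, consensusProjection A x = (η ⬝ᵥ x) • ζ) : oneNorm η ≤ 1 := by
  obtain ⟨x, hx, hηx⟩ := exists_isUnimodular_dotProduct_eq_oneNorm η
  have hone : 0 ≤ oneNorm η := Finset.sum_nonneg fun i _ => norm_nonneg (η i)
  calc oneNorm η = ‖consensusProjection A x 0‖ := by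
        simp [hP, hηx, hζ 0, abs_of_nonneg hone]
    _ ≤ ‖consensusProjection A x‖ := norm_le_pi_norm _ 0
    _ ≤ ‖x‖ := norm_consensusProjection_le A x
    _ ≤ 1 := (pi_norm_le_iff_of_nonneg zero_le_one).mpr fun i => (hx i).le

theorem IsUnimodular.isNormalizedLeftEigenvector_iff_consensusProjection
    (hG : HasSpanningTree (graph A)) (hζ : IsUnimodular ζ) (hLζ : (laplacian A).mulVec ζ = 0) :
    IsNormalizedLeftEigenvector A ζ η ↔ ∀ x, consensusProjection A x = (η ⬝ᵥ x) • ζ := by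
  rw [hζ.isNormalizedLeftEigenvector_iff]
  constructor
  · rintro ⟨-, hleft, hdot⟩ x
    obtain ⟨c, hc⟩ := eq_smul_of_laplacian_mulVec_eq_zero hG hζ hLζ
      (laplacian_mulVec_consensusProjection A x)
    have hx := dotProduct_consensusProjection hleft x
    rw [hc, dotProduct_smul, hdot, smul_eq_mul, mul_one] at hx
    rw [hc, hx]
  · intro hP
    have hζ_ne : ζ ≠ 0 := fun h => hζ.ne_zero 0 (congrFun h 0)
    have hleft : Matrix.vecMul η (laplacian A) = 0 := dotProduct_eq_zero _ fun x => by
      rw [← Matrix.dotProduct_mulVec]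
      refine (smul_eq_zero.mp ?_).resolve_right hζ_ne
      rw [← hP, consensusProjection_laplacian_mulVec]
    have hdot : η ⬝ᵥ ζ = 1 := smul_left_injective ℂ hζ_ne <| by
      simp only [← hP, consensusProjection_eq_self hLζ, one_smul]
    refine ⟨le_antisymm (hζ.oneNorm_le_one_of_consensusProjection hP) ?_, hleft, hdot⟩
    simpa [hdot] using hζ.norm_dotProduct_le_oneNorm η

theorem IsUnimodular.exists_consensusProjection_eq (hG : HasSpanningTree (graph A))
    (hζ : IsUnimodular ζ) (hLζ : (laplacian A).mulVec ζ = 0) :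
    ∃ η : Fin n → ℂ, ∀ x, consensusProjection A x = (η ⬝ᵥ x) • ζ := by
  let c : Module.Dual ℂ (Fin n → ℂ) := (ζ 0)⁻¹ • (LinearMap.proj 0 ∘ₗ consensusProjection A)
  refine ⟨(dotProductEquiv ℂ (Fin n)).symm c, fun x => ?_⟩
  have hc : (dotProductEquiv ℂ (Fin n)).symm c ⬝ᵥ x = c x :=
    LinearMap.congr_fun ((dotProductEquiv ℂ (Fin n)).apply_symm_apply c) x
  obtain ⟨a, ha⟩ := eq_smul_of_laplacian_mulVec_eq_zero hG hζ hLζ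
    (laplacian_mulVec_consensusProjection A x)
  have hca : c x = a := by simp [c, ha, hζ.ne_zero 0, mul_comm a]
  rw [hc, hca, ha]

theorem IsUnimodular.existsUnique_isNormalizedLeftEigenvector (hG : HasSpanningTree (graph A))
    (hζ : IsUnimodular ζ) (hLζ : (laplacian A).mulVec ζ = 0) :
    ∃! η : Fin n → ℂ, IsNormalizedLeftEigenvector A ζ η := by
  simp only [hζ.isNormalizedLeftEigenvector_iff_consensusProjection hG hLζ]
  obtain ⟨η, hη⟩ := hζ.exists_consensusProjection_eq hG hLζ
  have hζ_ne : ζ ≠ 0 := fun h => hζ.ne_zero 0 (congrFun h 0)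
  refine ⟨η, hη, fun θ hθ => dotProduct_eq _ _ fun x => smul_left_injective ℂ hζ_ne ?_⟩
  exact (hθ x).symm.trans (hη x)

end LeftEigenvector

section Consensus

variable {n : ℕ} {A : Matrix (Fin n) (Fin n) ℂ} {ζ η x : Fin n → ℂ} {κ : ℝ}

theorem ae_dotProduct_ne_zero (hη : η ≠ 0) : ∀ᵐ x : Fin n → ℂ, η ⬝ᵥ x ≠ 0 := by
  let V : Submodule ℝ (Fin n → ℂ) := (dotProductEquiv ℂ (Fin n) η).ker.restrictScalars ℝ
  have hV : V ≠ ⊤ := fun htop => hη <| dotProduct_eq_zero η fun x =>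
    show x ∈ V from htop ▸ Submodule.mem_top
  exact measure_eq_zero_iff_ae_notMem.mp (Measure.addHaar_submodule volume V hV)

theorem hasSpanningTree_of_forall_exists_common_ancestor [NeZero n] {G : Digraph (Fin n)}
    (hG : ∀ i j, ∃ k, Relation.ReflTransGen G.Adj k i ∧ Relation.ReflTransGen G.Adj k j) :
    HasSpanningTree G := by
  have : IsTrans (Fin n) fun i k => Relation.ReflTransGen G.Adj k i :=
    ⟨fun _ _ _ hji hkj => hkj.trans hji⟩
  exact Directed.finite_le (r := fun i k => Relation.ReflTransGen G.Adj k i) (f := id) hG id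

variable [NeZero n]

theorem consensusProjection_apply_eq_zero {C : Set (Fin n)}
    (hC : ∀ i ∈ C, ∀ j, (graph A).Adj j i → j ∈ C) (hx : ∀ i ∈ C, x i = 0) :
    ∀ i ∈ C, consensusProjection A x i = 0 := by
  let V : Submodule ℂ (Fin n → ℂ) := Submodule.pi C fun _ => ⊥
  have hV : ∀ y ∈ V, laplacianOp A y ∈ V := fun y hy i hi => by
    have hsum : ∑ j, A i j * y j = 0 := Finset.sum_eq_zero fun j _ => by
      by_cases hij : A i j = 0
      · rw [hij, zero_mul]
      · rw [show y j = 0 from hy j (hC i hi j hij), mul_zero]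
    have hyi : y i = 0 := hy i hi
    change laplacianOp A y i = 0
    rw [laplacianOp_apply, laplacian_mulVec_apply, hsum, hyi, mul_zero, sub_zero]
  exact projection_ker_mem (norm_algebraMap_sub_laplacianOp_le A) hV hx

theorem hasSpanningTree_of_forall_norm_consensusProjection_eq
    (hnorm : ∀ x i j, ‖consensusProjection A x i‖ = ‖consensusProjection A x j‖)
    (hζ : IsUnimodular ζ) (hLζ : (laplacian A).mulVec ζ = 0) : HasSpanningTree (graph A) := by
  classical
  refine hasSpanningTree_of_forall_exists_common_ancestor fun i j => ?_
  by_contra! hcommon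
  let ancestors (i : Fin n) : Set (Fin n) := {k | Relation.ReflTransGen (graph A).Adj k i}
  have hclosed (i k) (hk : k ∈ ancestors i) (l) (hlk : (graph A).Adj l k) : l ∈ ancestors i :=
    Relation.ReflTransGen.head hlk hk
  have hself (i : Fin n) : i ∈ ancestors i := Relation.ReflTransGen.refl
  let x := (ancestors j).indicator ζ
  have hx (k) (hk : k ∈ ancestors i) : x k = 0 :=
    Set.indicator_of_notMem (show k ∉ ancestors j from hcommon k hk) ζ
  have hxζ (k) (hk : k ∈ ancestors j) : (x - ζ) k = 0 :=
    sub_eq_zero.mpr (Set.indicator_of_mem hk ζ)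
  have hi := consensusProjection_apply_eq_zero (hclosed i) hx i (hself i)
  have hj := consensusProjection_apply_eq_zero (hclosed j) hxζ j (hself j)
  rw [map_sub, consensusProjection_eq_self hLζ, Pi.sub_apply, sub_eq_zero] at hj
  have hmod := hnorm x i j
  rw [hi, hj, norm_zero, hζ j] at hmod
  exact zero_ne_one hmod

theorem norm_consensusProjection_eq_of_ae
    (h : ∀ᵐ x : Fin n → ℂ, ∃ a : ℝ, 0 < a ∧ ∀ i, ‖consensusProjection A x i‖ = a)
    (x : Fin n → ℂ) (i j : Fin n) :
    ‖consensusProjection A x i‖ = ‖consensusProjection A x j‖ := by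
  have hcont (k : Fin n) : Continuous fun x => ‖consensusProjection A x k‖ :=
    ((continuous_apply k).comp (consensusProjection A).continuous_of_finiteDimensional).norm
  refine congrFun (((hcont i).ae_eq_iff_eq volume (hcont j)).mp ?_) x
  filter_upwards [h] with x ⟨a, _, hx⟩
  rw [hx i, hx j]

theorem exists_isUnimodular_laplacian_mulVec_eq_zero {a : ℝ} (ha : 0 < a)
    (hx : ∀ i, ‖consensusProjection A x i‖ = a) :
    ∃ ζ, IsUnimodular ζ ∧ (laplacian A).mulVec ζ = 0 := by
  refine ⟨(a : ℂ)⁻¹ • consensusProjection A x, fun i => ?_, ?_⟩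
  · rw [Pi.smul_apply, norm_smul, hx i, norm_inv, Complex.norm_real, Real.norm_of_nonneg ha.le,
      inv_mul_cancel₀ ha.ne']
  · rw [Matrix.mulVec_smul, laplacian_mulVec_consensusProjection, smul_zero]

theorem reachesComplexConsensus_iff_essentiallyNonnegative_and_hasSpanningTree (hκ : 0 < κ) :
    ReachesComplexConsensus κ A ↔ EssentiallyNonnegative A ∧ HasSpanningTree (graph A) := by
  rw [reachesComplexConsensus_iff hκ, essentiallyNonnegative_iff]
  constructor
  · intro h
    obtain ⟨x, a, ha, hx⟩ := h.exists
    obtain ⟨ζ, hζ, hLζ⟩ := exists_isUnimodular_laplacian_mulVec_eq_zero ha hx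
    exact ⟨⟨ζ, hζ, hLζ⟩, hasSpanningTree_of_forall_norm_consensusProjection_eq
      (norm_consensusProjection_eq_of_ae h) hζ hLζ⟩
  · rintro ⟨⟨ζ, hζ, hLζ⟩, hG⟩
    obtain ⟨η, hP⟩ := hζ.exists_consensusProjection_eq hG hLζ
    have hη : η ≠ 0 := by
      rintro rfl
      have h0 := congrFun (hP ζ) 0
      simp [consensusProjection_eq_self hLζ, hζ.ne_zero] at h0
    filter_upwards [ae_dotProduct_ne_zero hη] with x hx
    exact ⟨‖η ⬝ᵥ x‖, norm_pos_iff.mpr hx, fun i => by simp [hP, hζ i]⟩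

end Consensus

theorem mainTheorem1_general {n : ℕ} (hn : 0 < n) (κ : ℝ) (hκ : 0 < κ)
    (A : Matrix (Fin n) (Fin n) ℂ) :
    (ReachesComplexConsensus κ A ↔ EssentiallyNonnegative A ∧ HasSpanningTree (graph A)) ∧
    (EssentiallyNonnegative A ∧ HasSpanningTree (graph A) →
      (∃ ζ : Fin n → ℂ, IsUnimodular ζ ∧ (laplacian A).mulVec ζ = 0) ∧
      ∀ ζ : Fin n → ℂ, IsUnimodular ζ → (laplacian A).mulVec ζ = 0 →
        (∀ y : Fin n → ℂ, (laplacian A).mulVec y = 0 → ∃ c : ℂ, y = c • ζ) ∧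
        (∃! η : Fin n → ℂ, IsNormalizedLeftEigenvector A ζ η) ∧
        ∀ η : Fin n → ℂ, IsNormalizedLeftEigenvector A ζ η →
          oneNorm η = 1 ∧
          Matrix.vecMul η (laplacian A) = 0 ∧
          ∀ z : ℝ → Fin n → ℂ, IsTrajectory κ A z →
            Tendsto z atTop (𝓝 ((η ⬝ᵥ z 0) • ζ))) := by
  have : NeZero n := ⟨hn.ne'⟩
  refine ⟨reachesComplexConsensus_iff_essentiallyNonnegative_and_hasSpanningTree hκ, ?_⟩
  rintro ⟨hA, hG⟩
  refine ⟨essentiallyNonnegative_iff.mp hA, fun ζ hζ hLζ => ⟨fun y hy => ?_, ?_, fun η hη => ?_⟩⟩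
  · exact eq_smul_of_laplacian_mulVec_eq_zero hG hζ hLζ hy
  · exact hζ.existsUnique_isNormalizedLeftEigenvector hG hLζ
  · obtain ⟨hone, hleft, -⟩ := hζ.isNormalizedLeftEigenvector_iff.mp hη
    have hP := (hζ.isNormalizedLeftEigenvector_iff_consensusProjection hG hLζ).mp hη
    exact ⟨hone, hleft, fun z hz => hP (z 0) ▸ hz.tendsto_consensusProjection hκ⟩

end ComplexConsensus

end

theorem mainTheorem1 {n : ℕ} (hn : 0 < n) (κ : ℝ) (hκ : 0 < κ)
    (A : Matrix (Fin n) (Fin n) ℂ) (hA : ∀ i, A i i = 0) :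
    (ComplexConsensus.ReachesComplexConsensus κ A ↔
      ComplexConsensus.EssentiallyNonnegative A ∧
        ComplexConsensus.HasSpanningTree (ComplexConsensus.graph A)) ∧
    (ComplexConsensus.EssentiallyNonnegative A ∧
        ComplexConsensus.HasSpanningTree (ComplexConsensus.graph A) →
      -- a zero-eigenvector `ζ ∈ 𝕋ⁿ` of `L` exists
      (∃ ζ : Fin n → ℂ, ComplexConsensus.IsUnimodular ζ ∧
        (ComplexConsensus.laplacian A).mulVec ζ = 0) ∧
      ∀ ζ : Fin n → ℂ, ComplexConsensus.IsUnimodular ζ →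
        (ComplexConsensus.laplacian A).mulVec ζ = 0 →
        -- `ζ` is unique up to a scalar, and `η` is uniquely determined by `ζ`
        (∀ y : Fin n → ℂ, (ComplexConsensus.laplacian A).mulVec y = 0 → ∃ c : ℂ, y = c • ζ) ∧
        (∃! η : Fin n → ℂ, ComplexConsensus.IsNormalizedLeftEigenvector A ζ η) ∧
        ∀ η : Fin n → ℂ, ComplexConsensus.IsNormalizedLeftEigenvector A ζ η →
          ComplexConsensus.oneNorm η = 1 ∧
          Matrix.vecMul η (ComplexConsensus.laplacian A) = 0 ∧
          ∀ z : ℝ → Fin n → ℂ, ComplexConsensus.IsTrajectory κ A z →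
            Tendsto z atTop (𝓝 ((η ⬝ᵥ z 0) • ζ))) :=
  ComplexConsensus.mainTheorem1_general hn κ hκ A
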